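/- **Setting.** For a finite set of $r$ bosonic modes let $\mathcal H_r=\ell^2(\mathbb N^r)$ be the Fock space with orthonormal Fock basis $|k\rangle$, $k\in\mathbb N^r$, and for $w\in\mathbb C^r$ let $|w\rangle=e^{-\|w\|^2/2}\sum_{k}\bigl(\prod_i w_i^{k_i}/\sqrt{k_i!}\bigr)|k\rangle$ be the coherent state. A state is a positive operator of trace one. The Bargmann function of a vector $\psi$ is $F_\psi(z)=e^{\|z\|^2/2}\langle z^*|\psi\rangle$, and that of an operator $\rho$ is $F_\rho(w,z)=e^{(\|z\|^2+\|w\|^2)/2}\langle z^*|\rho|w\rangle$. Let the modes be split into subsystems $M$ ($m\ge 0$ modes) and $N$ ($n\ge 0$ modes), $M$ listed first. In mode-wise order the variables of $F_\rho$ are listed as $v=(w_1,z_1,\dots,w_{m+n},z_{m+n})$, so that the first $2m$ variables belong to $M$ and the last $2n$ to $N$. A state $\rho$ is Gaussian if $$F_\rho = c\,\exp\bigl(\tfrac12 v^{\mathrm T}A_\rho v+v^{\mathrm T}b_\rho\bigr)$$ for some complex symmetric $A_\rho\in\mathbb C^{2(m+n)\times 2(m+n)}$, $b_\rho\in\mathbb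 C^{2(m+n)}$ and $c\in\mathbb C$. A Gaussian state $\rho$ is a *Gaussian core state* if for all $k_1,k_2\in\mathbb N^n$ the operator $(\mathbb 1_M\otimes\langle k_1|_N)\,\rho\,(\mathbb 1_M\otimes|k_2\rangle_N)$ has only finitely many nonzero matrix elements in the Fock basis. The stellar rank of a vector $\psi$ is the degree of the polynomial $P$ if $F_\psi(z)=P(z)\exp(\frac12z^{\mathrm T}Az+z^{\mathrm T}b)$ for some polynomial $P$, symmetric matrix $A$ and vector $b$, and $\infty$ if $F_\psi$ is not of this form; the zero vector has rank $0$. The stellar rank of a (not necessarily normalized, possibly mixed) state $T$ is the infimum, over all countable decompositions $T=\sum_i|\psi_i\rangle\langle\psi_i|$, of the supremum of the stellar ranks of the $\psi_i$. **Proposition.** Let $\rho$ be a Gaussian state over $MN$ and let $(A_\rho,b_\rho)$ be its parameters in mode-wise order. Then $\rho$ is a Gaussian core state if and only if $$A_\rho=\begin{bmatrix}0&\ast\\ \ast&\ast\end{bmatrix},\qquad b_\rho=\begin{bmatrix}0\\ \ast\end{bmatrix},$$ that is, the top-left $2m\times 2m$ block of $A_\rho$ (the $(M,M)$ block) and the first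 $2m$ entries of $b_\rho$ (the $M$-part) vanish. Moreover, if $\rho$ is a Gaussian core state, then for every $k\in\mathbb N^n$ the stellar rank of the (unnormalized) post-selected state $(\mathbb 1\otimes\langle k|)\,\rho\,(\mathbb 1\otimes|k\rangle)$ is at most $\|k\|_1=\sum_j k_j$. -/

import Mathlib

noncomputable section

namespace Bosonic

open scoped ComplexConjugate Matrix

/-- The Hilbert space of finitely many bosonic modes labelled by `ι`: square-summable families of
Fock amplitudes, indexed by the photon-number patterns `ι → ℕ`. -/
abbrev Fock (ι : Type*) : Type _ := lp (fun _ : ι → ℕ => ℂ) 2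

variable {ι κ : Type*} [Fintype ι] [Fintype κ]

/-- The Fock state `|k⟩`. -/
def ket (k : ι → ℕ) : Fock ι := by
  classical exact lp.single 2 k (1 : ℂ)

/-! ### Coherent states -/

/-- The Fock amplitudes `∏ i, w i ^ k i / √(k i)!` of the rescaled coherent state. -/
def expAmp (w : ι → ℂ) (k : ι → ℕ) : ℂ := ∏ i, w i ^ k i / (Real.sqrt (k i).factorial : ℂ)

theorem norm_expAmp_sq (w : ι → ℂ) (k : ι → ℕ) :
    ‖expAmp w k‖ ^ 2 = ∏ i, (‖w i‖ ^ 2) ^ k i / ((k i).factorial : ℝ) := by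
  rw [expAmp, norm_prod, ← Finset.prod_pow]
  refine Finset.prod_congr rfl fun i _ => ?_
  rw [norm_div, norm_pow, div_pow, Complex.norm_real, Real.norm_of_nonneg (Real.sqrt_nonneg _),
    Real.sq_sqrt (Nat.cast_nonneg _), ← pow_mul, ← pow_mul, mul_comm]

theorem sum_norm_expAmp_sq_le (w : ι → ℂ) (s : Finset (ι → ℕ)) :
    ∑ k ∈ s, ‖expAmp w k‖ ^ 2 ≤ ∏ i, Real.exp (‖w i‖ ^ 2) := by
  classical
  obtain ⟨N, hN⟩ : ∃ N : ℕ, ∀ k ∈ s, ∀ i, k i < N := by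
    refine ⟨(s.sup fun k => Finset.univ.sup k) + 1, fun k hk i => Nat.lt_succ_of_le ?_⟩
    exact (Finset.le_sup (f := k) (Finset.mem_univ i)).trans
      (Finset.le_sup (f := fun k : ι → ℕ => Finset.univ.sup k) hk)
  have hs : s ⊆ Fintype.piFinset fun _ : ι => Finset.range N := fun k hk =>
    Fintype.mem_piFinset.2 fun i => Finset.mem_range.2 (hN k hk i)
  have hnn : ∀ i (j : ℕ), 0 ≤ (‖w i‖ ^ 2) ^ j / (j.factorial : ℝ) := fun i j =>
    div_nonneg (pow_nonneg (sq_nonneg _) _) (Nat.cast_nonneg _)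
  simp only [norm_expAmp_sq]
  refine (Finset.sum_le_sum_of_subset_of_nonneg hs fun k _ _ =>
    Finset.prod_nonneg fun i _ => hnn i (k i)).trans ?_
  rw [← Finset.prod_univ_sum (fun _ : ι => Finset.range N)
    (fun i j => (‖w i‖ ^ 2) ^ j / (j.factorial : ℝ))]
  exact Finset.prod_le_prod (fun i _ => Finset.sum_nonneg fun j _ => hnn i j)
    fun i _ => Real.sum_le_exp_of_nonneg (sq_nonneg _) N

theorem expAmp_memℓp (w : ι → ℂ) :
    Memℓp (E := fun _ : ι → ℕ => ℂ) (expAmp w) 2 := by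
  refine memℓp_gen' (C := ∏ i, Real.exp (‖w i‖ ^ 2)) fun s => ?_
  simpa only [ENNReal.toReal_ofNat, Real.rpow_ofNat] using sum_norm_expAmp_sq_le w s

/-- The (normalized) coherent state `|w⟩ = e^{-‖w‖²/2} ∑ₖ (∏ i, w i ^ k i / √(k i)!) |k⟩`. -/
def coherent (w : ι → ℂ) : Fock ι :=
  (Real.exp (-(∑ i, ‖w i‖ ^ 2) / 2) : ℂ) • (⟨expAmp w, expAmp_memℓp w⟩ : Fock ι)

/-! ### Bargmann functions -/

/-- The Bargmann (stellar) function `F_ψ(z) = e^{‖z‖²/2} ⟨z*|ψ⟩` of a vector. -/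
def vecBargmann (ψ : Fock ι) (z : ι → ℂ) : ℂ :=
  (Real.exp ((∑ i, ‖z i‖ ^ 2) / 2) : ℂ) * inner ℂ (coherent (star z)) ψ

/-- The Bargmann function `F_ρ(w, z) = e^{(‖z‖² + ‖w‖²)/2} ⟨z*| ρ |w⟩` of an operator;
`w` are the bra variables and `z` the ket variables. -/
def opBargmann (ρ : Fock ι →L[ℂ] Fock ι) (w z : ι → ℂ) : ℂ :=
  (Real.exp (((∑ i, ‖z i‖ ^ 2) + ∑ i, ‖w i‖ ^ 2) / 2) : ℂ)
    * inner ℂ (coherent (star z)) (ρ (coherent w))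

/-- The function `v ↦ exp (½ vᵀ A v + vᵀ b)`. -/
def gaussExp {σ : Type*} [Fintype σ] (A : Matrix σ σ ℂ) (b v : σ → ℂ) : ℂ :=
  Complex.exp ((1 / 2) * (v ⬝ᵥ (A *ᵥ v)) + v ⬝ᵥ b)

/-! ### States and Gaussian states over a bipartition -/

/-- Density operators: positive operators whose trace, computed in the Fock basis, is one. -/
def IsState (ρ : Fock ι →L[ℂ] Fock ι) : Prop :=
  ρ.IsPositive ∧ HasSum (fun k : ι → ℕ => inner ℂ (ket k) (ρ (ket k))) 1

/-- Labels of the variables of the Bargmann function of an operator in mode-wise order: first the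
modes of the subsystem `ι`, then those of `κ`; each mode carries its bra variable (`0`) followed by
its ket variable (`1`). -/
abbrev ModeWise (ι κ : Type*) : Type _ := (ι × Fin 2) ⊕ (κ × Fin 2)

/-- The variables `(w₁, z₁, w₂, z₂, …)` in mode-wise order. -/
def modeWise (w z : ι ⊕ κ → ℂ) : ModeWise ι κ → ℂ
  | Sum.inl p => ![w (Sum.inl p.1), z (Sum.inl p.1)] p.2
  | Sum.inr p => ![w (Sum.inr p.1), z (Sum.inr p.1)] p.2

/-- `(A, b, c)` is an Abc parametrization of `ρ` in mode-wise order. -/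
def HasAbc (ρ : Fock (ι ⊕ κ) →L[ℂ] Fock (ι ⊕ κ)) (A : Matrix (ModeWise ι κ) (ModeWise ι κ) ℂ)
    (b : ModeWise ι κ → ℂ) (c : ℂ) : Prop :=
  A.IsSymm ∧ ∀ w z : ι ⊕ κ → ℂ, opBargmann ρ w z = c * gaussExp A b (modeWise w z)

/-- Gaussian states: density operators whose Bargmann function is a Gaussian function. -/
def IsGaussianState (ρ : Fock (ι ⊕ κ) →L[ℂ] Fock (ι ⊕ κ)) : Prop :=
  IsState ρ ∧ ∃ A b c, HasAbc ρ A b c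

/-! ### Partial Fock matrix elements and Gaussian core states -/

/-- The Fock amplitudes of `ψ ⊗ |k⟩`, where `|j⟩ ⊗ |k⟩` is the Fock state with pattern
`(j, k)`. -/
def tensorAmp (k : κ → ℕ) (ψ : (ι → ℕ) → ℂ) (l : ι ⊕ κ → ℕ) : ℂ :=
  if (fun j => l (Sum.inr j)) = k then ψ fun i => l (Sum.inl i) else 0

theorem tensorAmp_hasSum {ι κ : Type*} [Fintype κ] (k : κ → ℕ) (ψ : Fock ι) :
    HasSum (fun l : ι ⊕ κ → ℕ => ‖tensorAmp k ψ l‖ ^ (2 : ENNReal).toReal)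
      (‖ψ‖ ^ (2 : ENNReal).toReal) := by
  have hinj : Function.Injective fun j : ι → ℕ => (Sum.elim j k : ι ⊕ κ → ℕ) := by
    intro a b h
    funext i
    exact congrFun h (Sum.inl i)
  rw [← hinj.hasSum_iff]
  · have h := lp.hasSum_norm (p := 2) (by simp) ψ
    convert h using 2 with j
    simp [tensorAmp]
  · intro l hl
    have : (fun j => l (Sum.inr j)) ≠ k := by
      rintro rfl
      exact hl ⟨fun i => l (Sum.inl i), by funext x; cases x <;> rfl⟩
    simp [tensorAmp, this]

theorem tensorAmp_memℓp {ι κ : Type*} [Fintype κ] (k : κ → ℕ) (ψ : Fock ι) :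
    Memℓp (E := fun _ : ι ⊕ κ → ℕ => ℂ) (tensorAmp k ψ) 2 :=
  memℓp_gen (tensorAmp_hasSum k ψ).summable

/-- The isometry `𝟙 ⊗ |k⟩`, that is, `ψ ↦ ψ ⊗ |k⟩`. -/
def tensorKet (k : κ → ℕ) : Fock ι →ₗᵢ[ℂ] Fock (ι ⊕ κ) where
  toFun ψ := ⟨tensorAmp k ψ, tensorAmp_memℓp k ψ⟩
  map_add' ψ φ := by
    ext l
    change tensorAmp k (⇑(ψ + φ)) l = tensorAmp k (⇑ψ) l + tensorAmp k (⇑φ) l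
    by_cases h : (fun j => l (Sum.inr j)) = k <;> simp [tensorAmp, h]
  map_smul' a ψ := by
    ext l
    by_cases h : (fun j => l (Sum.inr j)) = k <;> simp [tensorAmp, h]
  norm_map' ψ := by
    have h1 := lp.hasSum_norm (p := 2) (by simp)
      (⟨tensorAmp k ψ, tensorAmp_memℓp k ψ⟩ : Fock (ι ⊕ κ))
    have h2 := h1.unique (tensorAmp_hasSum k ψ)
    simp only [ENNReal.toReal_ofNat, Real.rpow_ofNat] at h2
    exact (pow_left_inj₀ (norm_nonneg _) (norm_nonneg _) two_ne_zero).1 h2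

/-- The operator `(𝟙 ⊗ ⟨k₁|) ρ (𝟙 ⊗ |k₂⟩)` on the first subsystem. -/
def partialElement (ρ : Fock (ι ⊕ κ) →L[ℂ] Fock (ι ⊕ κ)) (k₁ k₂ : κ → ℕ) :
    Fock ι →L[ℂ] Fock ι :=
  ContinuousLinearMap.adjoint (tensorKet k₁).toContinuousLinearMap ∘L ρ
    ∘L (tensorKet k₂).toContinuousLinearMap

/-- The (unnormalized) state `(𝟙 ⊗ ⟨k|) ρ (𝟙 ⊗ |k⟩)` of the first subsystem, conditioned on measuring
the Fock pattern `k` on the second one. -/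
def postSelected (ρ : Fock (ι ⊕ κ) →L[ℂ] Fock (ι ⊕ κ)) (k : κ → ℕ) : Fock ι →L[ℂ] Fock ι :=
  partialElement ρ k k

/-- Only finitely many Fock matrix elements `⟨j₁| T |j₂⟩` are nonzero. -/
def HasFiniteFockSupport (T : Fock ι →L[ℂ] Fock ι) : Prop :=
  {j : (ι → ℕ) × (ι → ℕ) | inner ℂ (ket j.1) (T (ket j.2)) ≠ 0}.Finite

/-- Gaussian core states over the bipartition `(ι, κ)`. -/
def IsGaussianCoreState (ρ : Fock (ι ⊕ κ) →L[ℂ] Fock (ι ⊕ κ)) : Prop :=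
  IsGaussianState ρ ∧ ∀ k₁ k₂ : κ → ℕ, HasFiniteFockSupport (partialElement ρ k₁ k₂)

/-! ### Stellar rank -/

/-- The stellar rank of a vector: the degree of the polynomial `P` when the stellar function is of
the form `P(z) exp (½ zᵀ A z + zᵀ b)`, and `⊤` when it is not of this form. It does not depend on
the normalization of the vector. -/
def vecStellarRank (ψ : Fock ι) : ℕ∞ :=
  ⨅ P ∈ {P : MvPolynomial ι ℂ | ∃ (A : Matrix ι ι ℂ) (b : ι → ℂ), A.IsSymm ∧
    ∀ z, vecBargmann ψ z = MvPolynomial.eval z P * gaussExp A b z}, (P.totalDegree : ℕ∞)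

/-- `T = ∑ᵢ |ψᵢ⟩⟨ψᵢ|`. The vectors need not be normalized and may vanish: a decomposition with
weights `pᵢ` into unit vectors `φᵢ` is written with `ψᵢ = √pᵢ φᵢ`, and a finite one is padded
with zeros. -/
def IsPureDecomposition (T : Fock ι →L[ℂ] Fock ι) (ψ : ℕ → Fock ι) : Prop :=
  ∀ x y : Fock ι, HasSum (fun i => inner ℂ x (ψ i) * inner ℂ (ψ i) y) (inner ℂ x (T y))

/-- The stellar rank of a (possibly mixed and unnormalized) state: the infimum, over all its
decompositions into pure states, of the largest stellar rank that occurs. -/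
def stellarRank (T : Fock ι →L[ℂ] Fock ι) : ℕ∞ :=
  ⨅ ψ ∈ {ψ : ℕ → Fock ι | IsPureDecomposition T ψ}, ⨆ i, vecStellarRank (ψ i)

end Bosonic

end

/-! The Bargmann function is the generating function of the Fock matrix, so entries of `ρ` are
Taylor coefficients and obey Cauchy estimates.

If the `M`-block and the `M`-part of `b` vanish, take radius `1/t` for the `M` variables and `t` for
the `N` variables. Every surviving term of the exponent stays bounded as `t → 0`, so Cauchy's
estimate kills each entry whose total `M`-degree exceeds its total `N`-degree
(`matrixElement_eq_zero`). Each partial element then has finite support.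

Conversely, projecting `N` on the vacuum sets the `N` variables to zero. For a core state the
remaining Gaussian is a polynomial along every complex line through the origin; having no zeros, it
is constant there, so its quadratic and linear parts vanish (`block_eq_zero`).

For the rank, a positive `T` with square root `S` decomposes as the sum of `S|k⟩⟨k|S`. A zero
diagonal entry of `T` at `k` means `S|k⟩ = 0`, so every `S|l⟩` has bounded photon number and a
polynomial Bargmann function (`stellarRank_le`). -/

namespace Bosonic

open scoped Matrix

variable {ι κ : Type*} [Fintype ι] [Fintype κ]

/-! ### Cauchy estimates in several variables -/

section Cauchy

attribute [local instance] instMeasureSpaceUnitAddCircle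
  instIsProbabilityMeasureUnitAddCircleVolume

/-- Cauchy's estimate on a polycircle. -/
theorem norm_coeff_mul_prod_le {V : Type*} [Fintype V] {a : (V → ℕ) → ℂ} {f : (V → ℂ) → ℂ}
    {r : V → ℝ} (hr : ∀ v, 0 ≤ r v) {C : ℝ}
    (hs : Summable fun α : V → ℕ => ‖a α‖ * ∏ v, r v ^ α v)
    (hf : ∀ x : V → ℂ, (∀ v, ‖x v‖ = r v) → HasSum (fun α => a α * ∏ v, x v ^ α v) (f x))
    (hC : ∀ x : V → ℂ, (∀ v, ‖x v‖ = r v) → ‖f x‖ ≤ C) (α : V → ℕ) :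
    ‖a α‖ * ∏ v, r v ^ α v ≤ C := by
  classical
  let c : (V → ℕ) → ℂ := fun β => a β * ∏ v, (r v : ℂ) ^ β v
  have hcn : ∀ β, ‖c β‖ = ‖a β‖ * ∏ v, r v ^ β v := fun β => by
    simp [c, norm_prod, abs_of_nonneg (hr _)]
  let e : (V → ℕ) → V → ℤ := fun β v => (β v : ℤ)
  have he : Function.Injective e := fun β γ h => funext fun v => by
    have := congrFun h v
    simpa [e] using this
  have hsum : Summable fun β => c β • UnitAddTorus.mFourier (e β) := by
    refine Summable.of_norm ?_
    simpa only [norm_smul, UnitAddTorus.mFourier_norm, mul_one, hcn] using hs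
  -- On the polycircle `f` becomes the Fourier series `F`, whose coefficient `c α` is an `L²` inner
  -- product with an orthonormal character.
  set F : C(UnitAddTorus V, ℂ) := ∑' β, c β • UnitAddTorus.mFourier (e β)
  have hFs : HasSum (fun β => c β • UnitAddTorus.mFourier (e β)) F := hsum.hasSum
  have hC0 : 0 ≤ C := (norm_nonneg _).trans (hC (fun v => (r v : ℂ)) fun v => by
    simp [abs_of_nonneg (hr v)])
  have hFC : ‖F‖ ≤ C := by
    refine (ContinuousMap.norm_le _ hC0).2 fun θ => ?_
    have hx : ∀ v, ‖(r v : ℂ) * fourier 1 (θ v)‖ = r v := fun v => by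
      rw [norm_mul, fourier_one, Circle.norm_coe, mul_one, Complex.norm_real,
        Real.norm_of_nonneg (hr v)]
    have h1 : HasSum (fun β => (c β • UnitAddTorus.mFourier (e β)) θ) (F θ) :=
      ContinuousMap.hasSum_apply hFs θ
    have h2 := hf _ hx
    have h3 : (fun β => (c β • UnitAddTorus.mFourier (e β)) θ)
        = fun β => a β * ∏ v, ((r v : ℂ) * fourier 1 (θ v)) ^ β v := by
      funext β
      simp only [ContinuousMap.smul_apply, smul_eq_mul, c, UnitAddTorus.mFourier,
        ContinuousMap.coe_mk, mul_pow, Finset.prod_mul_distrib, mul_assoc]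
      congr 2
      refine Finset.prod_congr rfl fun v _ => ?_
      simp [e, fourier_apply, AddCircle.toCircle_nsmul]
    rw [h3] at h1
    rw [h1.unique h2]
    exact hC _ hx
  let T := ContinuousMap.toLp (E := ℂ) 2 (MeasureTheory.volume : MeasureTheory.Measure
    (UnitAddTorus V)) ℂ
  have hort := UnitAddTorus.orthonormal_mFourier (d := V)
  have hin : inner ℂ (UnitAddTorus.mFourierLp 2 (e α)) (T F) = c α := by
    have h1 := (innerSL ℂ (UnitAddTorus.mFourierLp 2 (e α))).hasSum (T.hasSum hFs)
    refine h1.unique ((hasSum_ite_eq α (c α)).congr_fun fun β => ?_)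
    simp only [map_smul, innerSL_apply_apply, smul_eq_mul]
    rw [orthonormal_iff_ite.1 hort (e α) (e β)]
    by_cases h : β = α
    · simp [h]
    · simp [h, he.ne (Ne.symm h)]
  -- The torus carries a probability measure, so the `L²` norm is at most the sup norm.
  have hT : ‖T F‖ ≤ C := by
    refine (T.le_opNorm F).trans ?_
    have h1 : ‖T‖ ≤ 1 := by
      refine (ContinuousMap.toLp_norm_le (μ := MeasureTheory.volume)).trans ?_
      have hv : MeasureTheory.volume (Set.univ : Set (UnitAddTorus V)) = 1 :=
        MeasureTheory.measure_univ
      simp [MeasureTheory.measureUnivNNReal, hv]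
    calc ‖T‖ * ‖F‖ ≤ 1 * C := by gcongr
      _ = C := one_mul C
  rw [← hcn, ← hin]
  refine (norm_inner_le_norm _ _).trans ?_
  rw [hort.1, one_mul]
  exact hT

end Cauchy

/-! ### Expansion of the Bargmann function in monomials -/

/-- A finite set of multi-indices lies in a box, where the sum of products factors into a product of
sums. -/
theorem summable_prod_pi {f : ι → ℕ → ℝ} (hf : ∀ i j, 0 ≤ f i j) (hs : ∀ i, Summable (f i)) :
    Summable fun k : ι → ℕ => ∏ i, f i (k i) := by
  classical
  refine summable_of_sum_le (c := ∏ i, ∑' j, f i j)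
    (fun k => Finset.prod_nonneg fun i _ => hf i _) fun s => ?_
  obtain ⟨N, hN⟩ : ∃ N : ℕ, ∀ k ∈ s, ∀ i, k i < N := by
    refine ⟨(s.sup fun k => Finset.univ.sup k) + 1, fun k hk i => Nat.lt_succ_of_le ?_⟩
    exact (Finset.le_sup (f := k) (Finset.mem_univ i)).trans
      (Finset.le_sup (f := fun k : ι → ℕ => Finset.univ.sup k) hk)
  have hsN : s ⊆ Fintype.piFinset fun _ : ι => Finset.range N := fun k hk =>
    Fintype.mem_piFinset.2 fun i => Finset.mem_range.2 (hN k hk i)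
  refine (Finset.sum_le_sum_of_subset_of_nonneg hsN fun k _ _ =>
    Finset.prod_nonneg fun i _ => hf i (k i)).trans ?_
  rw [← Finset.prod_univ_sum (fun _ : ι => Finset.range N) (fun i j => f i j)]
  exact Finset.prod_le_prod (fun i _ => Finset.sum_nonneg fun j _ => hf i j)
    fun i _ => (hs i).sum_le_tsum _ fun j _ => hf i j

/-- The term is a product `a * b` with `a = (2r)^k / √k!` and `b = (1/2)^k`; both squares are
summable and `a * b ≤ a² + b²`. -/
theorem summable_pow_div_sqrt_factorial {r : ℝ} (hr : 0 ≤ r) :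
    Summable fun k : ℕ => r ^ k / Real.sqrt k.factorial := by
  have h1 := Real.summable_pow_div_factorial (4 * r ^ 2)
  have h2 : Summable fun k : ℕ => (1 / 4 : ℝ) ^ k :=
    summable_geometric_of_lt_one (by norm_num) (by norm_num)
  refine Summable.of_nonneg_of_le (fun k => by positivity) (fun k => ?_) (h1.add h2)
  have h3 : r ^ k / Real.sqrt k.factorial
      = ((2 * r) ^ k / Real.sqrt k.factorial) * (1 / 2) ^ k := by
    rw [mul_pow]
    have : (2 : ℝ) ^ k * (1 / 2) ^ k = 1 := by rw [← mul_pow]; norm_num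
    linear_combination (-(r ^ k / Real.sqrt k.factorial)) * this
  have h4 : (4 * r ^ 2) ^ k / (k.factorial : ℝ) = ((2 * r) ^ k / Real.sqrt k.factorial) ^ 2 := by
    rw [div_pow, Real.sq_sqrt (Nat.cast_nonneg _), ← pow_mul, mul_comm k 2, pow_mul]
    congr 2
    ring
  have h5 : (1 / 4 : ℝ) ^ k = ((1 / 2) ^ k) ^ 2 := by
    rw [← pow_mul, mul_comm k 2, pow_mul]; norm_num
  rw [h3, h4, h5]
  nlinarith [sq_nonneg ((2 * r) ^ k / Real.sqrt k.factorial - (1 / 2) ^ k),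
    sq_nonneg ((2 * r) ^ k / Real.sqrt k.factorial), sq_nonneg ((1 / 2 : ℝ) ^ k)]

theorem norm_expAmp (w : ι → ℂ) (k : ι → ℕ) :
    ‖expAmp w k‖ = ∏ i, ‖w i‖ ^ k i / Real.sqrt (k i).factorial := by
  simp [expAmp, norm_prod, abs_of_nonneg (Real.sqrt_nonneg _)]

theorem summable_norm_expAmp (w : ι → ℂ) : Summable fun k => ‖expAmp w k‖ := by
  simp only [norm_expAmp]
  exact summable_prod_pi (f := fun i j => ‖w i‖ ^ j / Real.sqrt j.factorial)
    (fun i j => by positivity) fun i => summable_pow_div_sqrt_factorial (norm_nonneg _)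

theorem expAmp_star (z : ι → ℂ) (k : ι → ℕ) : expAmp (star z) k = star (expAmp z k) := by
  simp [expAmp]

theorem inner_ket_left (k : ι → ℕ) (ψ : Fock ι) : inner ℂ (ket k) ψ = ψ k := by
  classical
  simp only [ket]
  rw [lp.inner_single_left]
  simp

theorem norm_ket (k : ι → ℕ) : ‖(ket k : Fock ι)‖ = 1 := by
  classical
  have h := inner_ket_left k (ket k)
  have h2 : (ket k : Fock ι) k = 1 := by
    simp only [ket]
    rw [lp.single_apply_self]
  rw [h2, inner_self_eq_norm_sq_to_K] at h
  have h3 : ‖(ket k : Fock ι)‖ ^ 2 = 1 := by simpa [← Complex.ofReal_pow, Complex.ofReal_eq_one] using h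
  exact (pow_eq_one_iff_of_nonneg (norm_nonneg _) two_ne_zero).1 h3

theorem hasSum_smul_ket (ψ : Fock ι) : HasSum (fun k => ψ k • (ket k : Fock ι)) ψ := by
  classical
  have h := lp.hasSum_single (p := 2) (by simp) ψ
  convert h using 2 with k
  simp only [ket]
  rw [← lp.single_smul]
  simp

/-- The unnormalized coherent state. -/
noncomputable def expVec (w : ι → ℂ) : Fock ι := ⟨expAmp w, expAmp_memℓp w⟩

theorem opBargmann_eq (ρ : Fock ι →L[ℂ] Fock ι) (w z : ι → ℂ) :
    opBargmann ρ w z = inner ℂ (expVec (star z)) (ρ (expVec w)) := by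
  have hs : ∀ z : ι → ℂ, ∑ i, ‖(star z) i‖ ^ 2 = ∑ i, ‖z i‖ ^ 2 := by simp
  change _ * inner ℂ (_ • expVec (star z)) (ρ (_ • expVec w)) = _
  rw [map_smul, inner_smul_left, inner_smul_right, hs, Complex.conj_ofReal, ← mul_assoc,
    ← mul_assoc, ← Complex.ofReal_mul, ← Complex.ofReal_mul, ← Real.exp_add, ← Real.exp_add]
  have : ((∑ i, ‖z i‖ ^ 2) + ∑ i, ‖w i‖ ^ 2) / 2 + -(∑ i, ‖z i‖ ^ 2) / 2
      + -(∑ i, ‖w i‖ ^ 2) / 2 = 0 := by ring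
  rw [this]
  simp

theorem vecBargmann_eq (ψ : Fock ι) (z : ι → ℂ) :
    vecBargmann ψ z = inner ℂ (expVec (star z)) ψ := by
  have hs : ∀ z : ι → ℂ, ∑ i, ‖(star z) i‖ ^ 2 = ∑ i, ‖z i‖ ^ 2 := by simp
  change _ * inner ℂ (_ • expVec (star z)) ψ = _
  rw [inner_smul_left, hs, Complex.conj_ofReal, ← mul_assoc, ← Complex.ofReal_mul, ← Real.exp_add]
  have : (∑ i, ‖z i‖ ^ 2) / 2 + -(∑ i, ‖z i‖ ^ 2) / 2 = 0 := by ring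
  rw [this]
  simp

theorem hasSum_vecBargmann (ψ : Fock ι) (z : ι → ℂ) :
    HasSum (fun k => expAmp z k * ψ k) (vecBargmann ψ z) := by
  rw [vecBargmann_eq]
  refine (lp.hasSum_inner (expVec (star z)) ψ).congr_fun fun k => ?_
  change _ = inner ℂ (expAmp (star z) k) (ψ k)
  rw [expAmp_star]
  simp [mul_comm]

theorem norm_matrixElement_le (ρ : Fock ι →L[ℂ] Fock ι) (j l : ι → ℕ) :
    ‖inner ℂ (ket j) (ρ (ket l))‖ ≤ ‖ρ‖ := by
  refine (norm_inner_le_norm _ _).trans ?_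
  rw [norm_ket, one_mul]
  refine (ρ.le_opNorm _).trans ?_
  rw [norm_ket, mul_one]

theorem summable_norm_opBargmann (ρ : Fock ι →L[ℂ] Fock ι) (w z : ι → ℂ) :
    Summable fun p : (ι → ℕ) × (ι → ℕ) =>
      ‖expAmp z p.1 * expAmp w p.2 * inner ℂ (ket p.1) (ρ (ket p.2))‖ := by
  have h := (summable_norm_expAmp z).mul_of_nonneg (summable_norm_expAmp w)
    (fun _ => norm_nonneg _) (fun _ => norm_nonneg _)
  refine Summable.of_nonneg_of_le (fun _ => norm_nonneg _) (fun p => ?_) (h.mul_right ‖ρ‖)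
  rw [norm_mul, norm_mul]
  gcongr
  exact norm_matrixElement_le ρ _ _

/-- The Bargmann function of an operator is the generating function of its Fock matrix. -/
theorem hasSum_opBargmann (ρ : Fock ι →L[ℂ] Fock ι) (w z : ι → ℂ) :
    HasSum (fun p : (ι → ℕ) × (ι → ℕ) =>
      expAmp z p.1 * expAmp w p.2 * inner ℂ (ket p.1) (ρ (ket p.2))) (opBargmann ρ w z) := by
  have hsum := (summable_norm_opBargmann ρ w z).of_norm.hasSum
  have hrow : ∀ j, HasSum
      (fun l => expAmp z j * expAmp w l * inner ℂ (ket j) (ρ (ket l)))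
      (expAmp z j * ρ (expVec w) j) := fun j => by
    have h := (innerSL ℂ (ket j)).hasSum (ρ.hasSum (hasSum_smul_ket (expVec w)))
    simp only [map_smul, innerSL_apply_apply, inner_ket_left, smul_eq_mul] at h
    have h2 := h.mul_left (expAmp z j)
    refine h2.congr_fun fun l => ?_
    rw [inner_ket_left, mul_assoc]
    rfl
  -- Absolute summability provides some sum over pairs; summing by rows identifies it.
  have h1 := hsum.prod_fiberwise hrow
  have h2 := hasSum_vecBargmann (ρ (expVec w)) z
  rw [vecBargmann_eq, ← opBargmann_eq] at h2
  rwa [h1.unique h2] at hsum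

/-- Cauchy's estimate for the Fock matrix elements of an operator. -/
theorem norm_matrixElement_mul_prod_le (ρ : Fock ι →L[ℂ] Fock ι) {r : ι → ℝ} (hr : ∀ i, 0 ≤ r i)
    {C : ℝ} (hC : ∀ w z : ι → ℂ, (∀ i, ‖w i‖ = r i) → (∀ i, ‖z i‖ = r i) →
      ‖opBargmann ρ w z‖ ≤ C) (j l : ι → ℕ) :
    (∏ i, r i ^ j i / Real.sqrt (j i).factorial) * (∏ i, r i ^ l i / Real.sqrt (l i).factorial)
      * ‖inner ℂ (ket j) (ρ (ket l))‖ ≤ C := by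
  -- Ket and bra variables merge into one family over `ι ⊕ ι`, kets on the left.
  let e := Equiv.sumArrowEquivProdArrow ι ι ℕ
  let D : (ι → ℕ) → ℂ := fun k => ∏ i, (Real.sqrt (k i).factorial : ℂ)
  have hexp : ∀ (z : ι → ℂ) k, expAmp z k = (∏ i, z i ^ k i) / D k := fun z k => by
    simp [expAmp, D, Finset.prod_div_distrib]
  let a : (ι ⊕ ι → ℕ) → ℂ := fun α =>
    inner ℂ (ket (e α).1) (ρ (ket (e α).2)) / (D (e α).1 * D (e α).2)
  have hterm : ∀ (x : ι ⊕ ι → ℂ) α, a α * ∏ v, x v ^ α v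
      = expAmp (fun i => x (Sum.inl i)) (e α).1 * expAmp (fun i => x (Sum.inr i)) (e α).2
        * inner ℂ (ket (e α).1) (ρ (ket (e α).2)) := fun x α => by
    rw [hexp, hexp, Fintype.prod_sum_type]
    change _ / _ * ((∏ i, x (Sum.inl i) ^ (e α).1 i) * ∏ i, x (Sum.inr i) ^ (e α).2 i) = _
    ring
  have hrn : ∀ v, ‖((Sum.elim r r v : ℝ) : ℂ)‖ = Sum.elim r r v := fun v => by
    rw [Complex.norm_real, Real.norm_of_nonneg]
    cases v <;> exact hr _
  have hnorm : ∀ α, ‖a α‖ * ∏ v, Sum.elim r r v ^ α v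
      = ‖expAmp (fun i => (r i : ℂ)) (e α).1 * expAmp (fun i => (r i : ℂ)) (e α).2
        * inner ℂ (ket (e α).1) (ρ (ket (e α).2))‖ := fun α => by
    have := congrArg norm (hterm (fun v => ((Sum.elim r r v : ℝ) : ℂ)) α)
    simp only [norm_mul, norm_prod, norm_pow, hrn, Sum.elim_inl, Sum.elim_inr] at this ⊢
    exact this
  have key := norm_coeff_mul_prod_le (a := a)
    (f := fun x => opBargmann ρ (fun i => x (Sum.inr i)) (fun i => x (Sum.inl i)))
    (r := Sum.elim r r) (by rintro (i | i) <;> exact hr i) (C := C)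
    (by
      simp only [hnorm]
      exact (e.summable_iff).2 (summable_norm_opBargmann ρ (fun i => (r i : ℂ))
        (fun i => (r i : ℂ))))
    (fun x _ => ((e.hasSum_iff).2 (hasSum_opBargmann ρ _ _)).congr_fun fun α => hterm x α)
    (fun x hx => hC _ _ (fun i => hx (Sum.inr i)) fun i => hx (Sum.inl i)) (e.symm (j, l))
  rw [hnorm, Equiv.apply_symm_apply, norm_mul, norm_mul, norm_expAmp, norm_expAmp] at key
  simpa only [Complex.norm_real, Real.norm_of_nonneg (hr _)] using key

/-! ### Partial matrix elements and the vacuum projection -/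

open scoped Classical in
theorem ket_apply (k l : ι → ℕ) : (ket k : Fock ι) l = if l = k then 1 else 0 := by
  simp only [ket]
  rw [lp.single_apply, Pi.single_apply]

theorem tensorKet_apply {ι κ : Type*} [Fintype κ] (k : κ → ℕ) (ψ : Fock ι)
    (l : ι ⊕ κ → ℕ) :
    (tensorKet k ψ : Fock (ι ⊕ κ)) l = tensorAmp k ψ l := rfl

theorem tensorKet_ket (k : κ → ℕ) (j : ι → ℕ) :
    tensorKet k (ket j : Fock ι) = ket (Sum.elim j k) := by
  classical
  ext l
  rw [tensorKet_apply, tensorAmp, ket_apply, ket_apply, ← ite_and]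
  congr 1
  rw [eq_iff_iff]
  constructor
  · rintro ⟨rfl, rfl⟩
    funext x
    cases x <;> rfl
  · rintro rfl
    exact ⟨rfl, rfl⟩

theorem inner_partialElement {ι κ : Type*} [Fintype κ]
    (ρ : Fock (ι ⊕ κ) →L[ℂ] Fock (ι ⊕ κ)) (k₁ k₂ : κ → ℕ)
    (φ ψ : Fock ι) :
    inner ℂ φ (partialElement ρ k₁ k₂ ψ) = inner ℂ (tensorKet k₁ φ) (ρ (tensorKet k₂ ψ)) := by
  simp only [partialElement, ContinuousLinearMap.comp_apply]
  rw [ContinuousLinearMap.adjoint_inner_right]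
  rfl

theorem inner_ket_partialElement_ket (ρ : Fock (ι ⊕ κ) →L[ℂ] Fock (ι ⊕ κ)) (k₁ k₂ : κ → ℕ)
    (j l : ι → ℕ) :
    inner ℂ (ket j) (partialElement ρ k₁ k₂ (ket l))
      = inner ℂ (ket (Sum.elim j k₁)) (ρ (ket (Sum.elim l k₂))) := by
  rw [inner_partialElement, tensorKet_ket, tensorKet_ket]

/-- The vacuum is the unnormalized coherent state at `0`, because `0 ^ k` vanishes unless `k = 0`.
-/
theorem tensorKet_zero_expVec (w : ι → ℂ) :
    tensorKet (0 : κ → ℕ) (expVec w) = expVec (Sum.elim w 0) := by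
  classical
  ext l
  rw [tensorKet_apply]
  change (if _ then expAmp w _ else 0) = expAmp (Sum.elim w 0) l
  rw [expAmp, expAmp, Fintype.prod_sum_type]
  by_cases h : (fun j => l (Sum.inr j)) = 0
  · rw [if_pos h]
    have : ∀ x, l (Sum.inr x) = 0 := fun x => congrFun h x
    simp [this]
  · rw [if_neg h]
    obtain ⟨x, hx⟩ := Function.ne_iff.1 h
    symm
    refine mul_eq_zero_of_right _ (Finset.prod_eq_zero (Finset.mem_univ x) ?_)
    have hx' : l (Sum.inr x) ≠ 0 := hx
    simp [hx']

theorem opBargmann_partialElement_zero (ρ : Fock (ι ⊕ κ) →L[ℂ] Fock (ι ⊕ κ)) (w z : ι → ℂ) :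
    opBargmann (partialElement ρ 0 0) w z = opBargmann ρ (Sum.elim w 0) (Sum.elim z 0) := by
  rw [opBargmann_eq, opBargmann_eq, inner_partialElement, tensorKet_zero_expVec,
    tensorKet_zero_expVec]
  congr 2
  ext x
  cases x <;> simp

/-! ### Gaussian states with vanishing block are core states -/

/-- The bound is independent of `t`: mixed terms scale as `t⁻¹ * t = 1`, pure `N` terms carry
nonnegative powers of `t ≤ 1`, and terms growing with `t⁻¹` are absent. -/
theorem norm_gaussExp_le {A : Matrix (ModeWise ι κ) (ModeWise ι κ) ℂ} {b v : ModeWise ι κ → ℂ}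
    (hA : A.toBlocks₁₁ = 0) (hb : ∀ i, b (Sum.inl i) = 0) {t : ℝ} (ht : 0 < t) (ht1 : t ≤ 1)
    (hl : ∀ i, ‖v (Sum.inl i)‖ = t⁻¹) (hr : ∀ i, ‖v (Sum.inr i)‖ = t) :
    ‖gaussExp A b v‖ ≤ Real.exp ((1 / 2) * ∑ p, ∑ q, ‖A p q‖ + ∑ p, ‖b p‖) := by
  rw [gaussExp]
  refine (Complex.norm_exp_le_exp_norm _).trans (Real.exp_le_exp.2 ?_)
  refine (norm_add_le _ _).trans (add_le_add ?_ ?_)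
  · rw [norm_mul]
    have : ‖(1 / 2 : ℂ)‖ = 1 / 2 := by norm_num
    rw [this]
    refine mul_le_mul_of_nonneg_left ?_ (by norm_num)
    rw [dotProduct]
    refine norm_sum_le_of_le _ fun p _ => ?_
    rw [Matrix.mulVec, dotProduct, Finset.mul_sum]
    refine norm_sum_le_of_le _ fun q _ => ?_
    rw [norm_mul, norm_mul]
    have hti : t⁻¹ * t = 1 := inv_mul_cancel₀ ht.ne'
    have hn := norm_nonneg (A p q)
    rcases p with p | p <;> rcases q with q | q
    · have : A (Sum.inl p) (Sum.inl q) = 0 := congrFun (congrFun hA p) q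
      simp [this]
    · rw [hl, hr]
      exact le_of_eq (by linear_combination ‖A (Sum.inl p) (Sum.inr q)‖ * hti)
    · rw [hl, hr]
      exact le_of_eq (by linear_combination ‖A (Sum.inr p) (Sum.inl q)‖ * hti)
    · rw [hr, hr]
      nlinarith [mul_le_mul_of_nonneg_left (mul_le_one₀ ht1 ht.le ht1) hn]
  · rw [dotProduct]
    refine norm_sum_le_of_le _ fun p _ => ?_
    rw [norm_mul]
    rcases p with p | p
    · simp [hb]
    · rw [hr]
      exact mul_le_of_le_one_left (norm_nonneg _) ht1

theorem matrixElement_eq_zero {ρ : Fock (ι ⊕ κ) →L[ℂ] Fock (ι ⊕ κ)}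
    {A : Matrix (ModeWise ι κ) (ModeWise ι κ) ℂ} {b : ModeWise ι κ → ℂ} {c : ℂ}
    (h : HasAbc ρ A b c) (hA : A.toBlocks₁₁ = 0) (hb : ∀ i, b (Sum.inl i) = 0)
    {j l : ι → ℕ} {k₁ k₂ : κ → ℕ} (hlt : ∑ i, k₁ i + ∑ i, k₂ i < ∑ i, j i + ∑ i, l i) :
    inner ℂ (ket (Sum.elim j k₁)) (ρ (ket (Sum.elim l k₂))) = 0 := by
  set C := ‖c‖ * Real.exp ((1 / 2) * ∑ p, ∑ q, ‖A p q‖ + ∑ p, ‖b p‖)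
  set D : ℝ := (∏ i, Real.sqrt (Sum.elim j k₁ i).factorial)
    * ∏ i, Real.sqrt (Sum.elim l k₂ i).factorial with hD
  have hDpos : 0 < D := by
    refine mul_pos (Finset.prod_pos fun i _ => ?_) (Finset.prod_pos fun i _ => ?_) <;>
      exact Real.sqrt_pos.2 (Nat.cast_pos.2 (Nat.factorial_pos _))
  set X := ‖inner ℂ (ket (Sum.elim j k₁)) (ρ (ket (Sum.elim l k₂)))‖ with hX
  have hX0 : 0 ≤ X := norm_nonneg _
  have hC0 : 0 ≤ C := by positivity
  have key : ∀ t : ℝ, 0 < t → t ≤ 1 → X ≤ C * D * t := by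
    intro t ht ht1
    have h1 := norm_matrixElement_mul_prod_le ρ (r := Sum.elim (fun _ => t⁻¹) fun _ => t)
      (by rintro (i | i) <;> simp [ht.le]) (C := C) (fun w z hw hz => by
        rw [h.2, norm_mul]
        refine mul_le_mul_of_nonneg_left (norm_gaussExp_le hA hb ht ht1 ?_ ?_) (norm_nonneg _)
        · rintro ⟨i, s⟩
          fin_cases s
          · exact hw (Sum.inl i)
          · exact hz (Sum.inl i)
        · rintro ⟨i, s⟩
          fin_cases s
          · exact hw (Sum.inr i)
          · exact hz (Sum.inr i)) (Sum.elim j k₁) (Sum.elim l k₂)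
    rw [Finset.prod_div_distrib, Finset.prod_div_distrib, div_mul_div_comm, ← hD,
      Fintype.prod_sum_type, Fintype.prod_sum_type] at h1
    simp only [Sum.elim_inl, Sum.elim_inr, Finset.prod_pow_eq_pow_sum] at h1
    -- The degree excess is `d + 1 ≥ 1`, so Cauchy's estimate carries at least one factor `t`.
    obtain ⟨d, hd⟩ := Nat.exists_eq_add_of_lt hlt
    have h2 : t⁻¹ ^ (∑ i, j i) * t ^ (∑ i, k₁ i) * (t⁻¹ ^ (∑ i, l i) * t ^ (∑ i, k₂ i))
        = (t ^ (d + 1))⁻¹ := by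
      have : t⁻¹ ^ (∑ i, j i) * t ^ (∑ i, k₁ i) * (t⁻¹ ^ (∑ i, l i) * t ^ (∑ i, k₂ i))
          = t⁻¹ ^ (∑ i, j i + ∑ i, l i) * t ^ (∑ i, k₁ i + ∑ i, k₂ i) := by ring
      rw [this, hd, inv_pow, inv_mul_eq_iff_eq_mul₀ (by positivity), ← div_eq_mul_inv,
        eq_div_iff (by positivity)]
      ring
    rw [h2, div_mul_eq_mul_div, div_le_iff₀ hDpos, inv_mul_le_iff₀ (by positivity)] at h1
    have h3 : t ^ (d + 1) ≤ t := pow_le_of_le_one ht.le ht1 (Nat.succ_ne_zero d)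
    calc X ≤ t ^ (d + 1) * (C * D) := h1
      _ ≤ t * (C * D) := mul_le_mul_of_nonneg_right h3 (by positivity)
      _ = C * D * t := mul_comm _ _
  rw [← norm_eq_zero, ← hX]
  by_contra hne
  have hXpos : 0 < X := lt_of_le_of_ne hX0 (Ne.symm hne)
  have hCD : 0 ≤ C * D := by positivity
  -- With this `t` the bound reads `X * (X + C * D) ≤ C * D * X`, that is `X² ≤ 0`; no limit is
  -- needed.
  have h4 := key (X / (X + C * D)) (by positivity) (by rw [div_le_one (by positivity)]; linarith)
  rw [mul_div_assoc', le_div_iff₀ (by positivity)] at h4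
  nlinarith

theorem finite_setOf_sum_le (N : ℕ) : {j : ι → ℕ | ∑ i, j i ≤ N}.Finite := by
  classical
  refine (Set.finite_Icc 0 (fun _ : ι => N)).subset fun j hj => ⟨fun _ => Nat.zero_le _, fun i => ?_⟩
  exact (Finset.single_le_sum (f := j) (fun _ _ => Nat.zero_le _) (Finset.mem_univ i)).trans hj

theorem hasFiniteFockSupport_partialElement {ρ : Fock (ι ⊕ κ) →L[ℂ] Fock (ι ⊕ κ)}
    {A : Matrix (ModeWise ι κ) (ModeWise ι κ) ℂ} {b : ModeWise ι κ → ℂ} {c : ℂ}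
    (h : HasAbc ρ A b c) (hA : A.toBlocks₁₁ = 0) (hb : ∀ i, b (Sum.inl i) = 0) (k₁ k₂ : κ → ℕ) :
    HasFiniteFockSupport (partialElement ρ k₁ k₂) := by
  have hfin := finite_setOf_sum_le (ι := ι) (∑ i, k₁ i + ∑ i, k₂ i)
  refine (hfin.prod hfin).subset fun p hp => ?_
  have : ¬ (∑ i, k₁ i + ∑ i, k₂ i < ∑ i, p.1 i + ∑ i, p.2 i) := fun hlt =>
    hp (by rw [inner_ket_partialElement_ket, matrixElement_eq_zero h hA hb hlt])
  constructor <;> simp only [Set.mem_ofPred_eq] <;> omega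

/-! ### Core states have vanishing block -/

/-- A polynomial without zeros is constant over `ℂ`; differentiating the exponential then forces the
derivative of its exponent to vanish. -/
theorem coeff_eq_zero_of_exp_eq_polynomial {c α β : ℂ} (hc : c ≠ 0) {p : Polynomial ℂ}
    (h : ∀ t : ℂ, c * Complex.exp (α * t ^ 2 + β * t) = p.eval t) : α = 0 ∧ β = 0 := by
  have hdeg : ¬ 0 < p.degree := fun hp => by
    obtain ⟨t, ht⟩ := Complex.exists_root hp
    have := h t
    rw [ht.eq_zero] at this
    exact mul_ne_zero hc (Complex.exp_ne_zero _) this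
  have hp := Polynomial.eq_C_of_degree_le_zero (not_lt.1 hdeg)
  have h0 : ∀ t : ℂ, c * Complex.exp (α * t ^ 2 + β * t) = p.coeff 0 := fun t => by
    rw [h t, hp]; simp
  have hlin : ∀ t : ℂ, α * (2 * t) + β = 0 := fun t => by
    have h1 : HasDerivAt (fun t : ℂ => c * Complex.exp (α * t ^ 2 + β * t))
        (c * (Complex.exp (α * t ^ 2 + β * t) * (α * (2 * t) + β))) t := by
      refine HasDerivAt.const_mul c (HasDerivAt.cexp ?_)
      refine HasDerivAt.add ?_ ?_
      · simpa using (hasDerivAt_pow 2 t).const_mul α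
      · simpa using (hasDerivAt_id t).const_mul β
    have h2 : (fun t : ℂ => c * Complex.exp (α * t ^ 2 + β * t)) = fun _ => p.coeff 0 := funext h0
    rw [h2] at h1
    have h3 := h1.unique (hasDerivAt_const t (p.coeff 0))
    rcases mul_eq_zero.1 h3 with h4 | h4
    · exact absurd h4 hc
    · exact (mul_eq_zero.1 h4).resolve_left (Complex.exp_ne_zero _)
  have hβ : β = 0 := by simpa using hlin 0
  refine ⟨?_, hβ⟩
  simpa [hβ] using hlin 1

theorem expAmp_smul (t : ℂ) (z : ι → ℂ) (k : ι → ℕ) :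
    expAmp (t • z) k = t ^ (∑ i, k i) * expAmp z k := by
  simp only [expAmp, Pi.smul_apply, smul_eq_mul, mul_pow, mul_div_assoc, Finset.prod_mul_distrib,
    Finset.prod_pow_eq_pow_sum]

theorem exists_polynomial_opBargmann {T : Fock ι →L[ℂ] Fock ι} (hT : HasFiniteFockSupport T)
    (w z : ι → ℂ) :
    ∃ p : Polynomial ℂ, ∀ t : ℂ, opBargmann T (t • w) (t • z) = p.eval t := by
  refine ⟨∑ q ∈ hT.toFinset, Polynomial.C (expAmp z q.1 * expAmp w q.2
    * inner ℂ (ket q.1) (T (ket q.2))) * Polynomial.X ^ (∑ i, q.1 i + ∑ i, q.2 i), fun t => ?_⟩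
  have h1 := hasSum_opBargmann T (t • w) (t • z)
  have h2 := hasSum_sum_of_ne_finset_zero (L := .unconditional _) (s := hT.toFinset) (f := fun p : (ι → ℕ) × (ι → ℕ) =>
      expAmp (t • z) p.1 * expAmp (t • w) p.2 * inner ℂ (ket p.1) (T (ket p.2))) fun q hq => by
    have : inner ℂ (ket q.1) (T (ket q.2)) = 0 := by
      by_contra hne
      exact hq (hT.mem_toFinset.2 hne)
    simp only [this, mul_zero]
  rw [h1.unique h2, Polynomial.eval_finsetSum]
  refine Finset.sum_congr rfl fun q _ => ?_
  rw [expAmp_smul, expAmp_smul]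
  simp only [Polynomial.eval_mul, Polynomial.eval_C, Polynomial.eval_pow, Polynomial.eval_X]
  ring

/-- Cauchy's estimate with bound `0` would annihilate the diagonal, against trace one. This makes
the prefactor `c` of a Gaussian state nonzero. -/
theorem IsState.exists_opBargmann_ne_zero {ρ : Fock ι →L[ℂ] Fock ι} (hρ : IsState ρ) :
    ∃ w z, opBargmann ρ w z ≠ 0 := by
  by_contra! h
  have hz : ∀ k : ι → ℕ, inner ℂ (ket k) (ρ (ket k)) = 0 := fun k => by
    have h1 := norm_matrixElement_mul_prod_le ρ (r := fun _ => 1) (by simp) (C := 0)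
      (fun w z _ _ => by simp [h w z]) k k
    have h2 : 0 < ∏ i, (1 : ℝ) ^ k i / Real.sqrt (k i).factorial :=
      Finset.prod_pos fun i _ => by positivity
    by_contra hne
    exact absurd h1 (not_le.2 (mul_pos (mul_pos h2 h2) (norm_pos_iff.2 hne)))
  have h1 := hρ.2
  simp only [hz] at h1
  exact zero_ne_one (hasSum_zero.unique h1)

theorem gaussExp_elim_smul (A : Matrix (ModeWise ι κ) (ModeWise ι κ) ℂ) (b : ModeWise ι κ → ℂ)
    (u : ι × Fin 2 → ℂ) (t : ℂ) :
    gaussExp A b (Sum.elim (t • u) 0)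
      = Complex.exp ((1 / 2 * (u ⬝ᵥ (A.toBlocks₁₁ *ᵥ u))) * t ^ 2
        + (u ⬝ᵥ fun i => b (Sum.inl i)) * t) := by
  have h1 : (Sum.elim (t • u) 0 : ModeWise ι κ → ℂ) ⬝ᵥ (A *ᵥ Sum.elim (t • u) 0)
      = t ^ 2 * (u ⬝ᵥ (A.toBlocks₁₁ *ᵥ u)) := by
    simp only [dotProduct, Matrix.mulVec, Fintype.sum_sum_type, Sum.elim_inl, Sum.elim_inr,
      Pi.zero_apply, zero_mul, mul_zero, Finset.sum_const_zero, add_zero, Finset.mul_sum,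
      Pi.smul_apply, smul_eq_mul, Matrix.toBlocks₁₁, Matrix.of_apply]
    exact Finset.sum_congr rfl fun p _ => Finset.sum_congr rfl fun q _ => by ring
  have h2 : (Sum.elim (t • u) 0 : ModeWise ι κ → ℂ) ⬝ᵥ b
      = t * (u ⬝ᵥ fun i => b (Sum.inl i)) := by
    simp only [dotProduct, Fintype.sum_sum_type, Sum.elim_inl, Sum.elim_inr,
      Pi.zero_apply, zero_mul, Finset.sum_const_zero, add_zero, Finset.mul_sum,
      Pi.smul_apply, smul_eq_mul, mul_assoc]
  rw [gaussExp, h1, h2]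
  congr 1
  ring

theorem block_eq_zero {ρ : Fock (ι ⊕ κ) →L[ℂ] Fock (ι ⊕ κ)} (hρ : IsGaussianCoreState ρ)
    {A : Matrix (ModeWise ι κ) (ModeWise ι κ) ℂ} {b : ModeWise ι κ → ℂ} {c : ℂ}
    (h : HasAbc ρ A b c) : A.toBlocks₁₁ = 0 ∧ ∀ i, b (Sum.inl i) = 0 := by
  classical
  have hc : c ≠ 0 := by
    rintro rfl
    obtain ⟨w, z, hwz⟩ := hρ.1.1.exists_opBargmann_ne_zero
    exact hwz (by rw [h.2, zero_mul])
  have key : ∀ u : ι × Fin 2 → ℂ,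
      1 / 2 * (u ⬝ᵥ (A.toBlocks₁₁ *ᵥ u)) = 0 ∧ (u ⬝ᵥ fun i => b (Sum.inl i)) = 0 := fun u => by
    obtain ⟨p, hp⟩ := exists_polynomial_opBargmann (hρ.2 0 0) (fun i => u (i, 0))
      fun i => u (i, 1)
    refine coeff_eq_zero_of_exp_eq_polynomial hc (p := p) fun t => ?_
    rw [← gaussExp_elim_smul, ← hp, opBargmann_partialElement_zero, h.2]
    congr 2
    funext v
    rcases v with ⟨i, s⟩ | ⟨i, s⟩ <;> fin_cases s <;> simp [modeWise]
  refine ⟨?_, fun i => by simpa using (key (Pi.single i 1)).2⟩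
  have hdiag : ∀ p, A.toBlocks₁₁ p p = 0 := fun p => by
    simpa using (key (Pi.single p 1)).1
  have hsymm : ∀ p q, A.toBlocks₁₁ p q = A.toBlocks₁₁ q p := fun p q =>
    h.1.apply (Sum.inl q) (Sum.inl p)
  ext p q
  -- Polarization: with zero diagonal, only the two equal off-diagonal entries remain.
  have h1 := (key (Pi.single p 1 + Pi.single q 1)).1
  simp only [Matrix.mulVec_add, add_dotProduct, dotProduct_add, single_dotProduct,
    Matrix.mulVec_single_one, Matrix.col_apply, one_mul, hdiag] at h1
  rw [hsymm q p] at h1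
  simpa using h1

/-! ### Stellar rank -/

/-- A vector of bounded photon number has a polynomial Bargmann function, so the Gaussian factor can
be taken trivial. -/
theorem vecStellarRank_le {ψ : Fock ι} {d : ℕ} (h : ∀ k : ι → ℕ, d < ∑ i, k i → ψ k = 0) :
    vecStellarRank ψ ≤ d := by
  classical
  let S := (finite_setOf_sum_le (ι := ι) d).toFinset
  let P : MvPolynomial ι ℂ := ∑ k ∈ S, MvPolynomial.monomial (Finsupp.equivFunOnFinite.symm k)
    (ψ k / ∏ i, (Real.sqrt (k i).factorial : ℂ))
  have hP : P ∈ {P : MvPolynomial ι ℂ | ∃ (A : Matrix ι ι ℂ) (b : ι → ℂ), A.IsSymm ∧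
      ∀ z, vecBargmann ψ z = MvPolynomial.eval z P * gaussExp A b z} := by
    refine ⟨0, 0, Matrix.isSymm_zero, fun z => ?_⟩
    have h1 := hasSum_sum_of_ne_finset_zero (L := .unconditional _) (s := S) (f := fun k => expAmp z k * ψ k)
      fun k hk => by
        have : d < ∑ i, k i := by
          by_contra hle
          exact hk ((finite_setOf_sum_le (ι := ι) d).mem_toFinset.2 (not_lt.1 hle))
        simp only [h k this, mul_zero]
    rw [(hasSum_vecBargmann ψ z).unique h1]
    simp only [P, map_sum, MvPolynomial.eval_monomial, gaussExp, Matrix.zero_mulVec,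
      dotProduct_zero, mul_zero, add_zero, Complex.exp_zero, mul_one]
    refine Finset.sum_congr rfl fun k _ => ?_
    rw [expAmp, Finset.prod_div_distrib, Finsupp.prod_fintype _ _ (by simp)]
    simp only [Finsupp.equivFunOnFinite_symm_apply_apply]
    ring
  refine (iInf₂_le P hP).trans (Nat.cast_le.2 ?_)
  refine MvPolynomial.totalDegree_finsetSum_le fun k hk => ?_
  refine (MvPolynomial.totalDegree_monomial_le _ _).trans ?_
  have := (finite_setOf_sum_le (ι := ι) d).mem_toFinset.1 hk
  rw [Finsupp.sum_fintype _ _ (by simp)]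
  exact this

theorem postSelected_isPositive {ι κ : Type*} [Fintype κ]
    {ρ : Fock (ι ⊕ κ) →L[ℂ] Fock (ι ⊕ κ)} (hρ : ρ.IsPositive)
    (k : κ → ℕ) : (postSelected ρ k).IsPositive :=
  hρ.adjoint_conj (tensorKet k).toContinuousLinearMap

theorem hasSum_inner_ket_mul (x y : Fock ι) :
    HasSum (fun k => inner ℂ x (ket k) * inner ℂ (ket k) y) (inner ℂ x y) := by
  refine (lp.hasSum_inner x y).congr_fun fun k => ?_
  rw [← inner_conj_symm, inner_ket_left, inner_ket_left]
  simp [mul_comm]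

theorem exists_symmetric_sqrt {H : Type*} [NormedAddCommGroup H] [InnerProductSpace ℂ H]
    [CompleteSpace H] {T : H →L[ℂ] H} (hT : T.IsPositive) :
    ∃ S : H →L[ℂ] H, (∀ x y, inner ℂ (S x) y = inner ℂ x (S y)) ∧ ∀ x, S (S x) = T x := by
  have hT0 : 0 ≤ T := (ContinuousLinearMap.nonneg_iff_isPositive T).2 hT
  refine ⟨CFC.sqrt T, fun x y => ?_, fun x => ?_⟩
  · exact ((ContinuousLinearMap.nonneg_iff_isPositive _).1 (CFC.sqrt_nonneg T)).isSymmetric x y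
  · exact congrArg (fun f : H →L[ℂ] H => f x) (CFC.sqrt_mul_sqrt_self T hT0)

/-- A positive operator without diagonal Fock matrix elements beyond `d` photons has stellar rank
at most `d`. -/
theorem stellarRank_le {T : Fock ι →L[ℂ] Fock ι} (hT : T.IsPositive) {d : ℕ}
    (h : ∀ k : ι → ℕ, d < ∑ i, k i → inner ℂ (ket k) (T (ket k)) = 0) :
    stellarRank T ≤ d := by
  classical
  obtain ⟨S, hS, hSS⟩ := exists_symmetric_sqrt hT
  -- `‖S|k⟩‖² = ⟨k|T|k⟩`.
  have hSket : ∀ k : ι → ℕ, d < ∑ i, k i → S (ket k) = 0 := fun k hk => by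
    rw [← inner_self_eq_zero (𝕜 := ℂ), hS, hSS, h k hk]
  -- Decompositions are sequences over `ℕ`, so the family `S|k⟩` is transported along an injection
  -- and padded with zeros.
  obtain ⟨e, he⟩ := exists_injective_nat (ι → ℕ)
  let ψ : ℕ → Fock ι := Function.extend e (fun k => S (ket k)) 0
  have hψ : ∀ k, ψ (e k) = S (ket k) := fun k => he.extend_apply _ _ k
  have hψ0 : ∀ n, n ∉ Set.range e → ψ n = 0 := fun n hn => Function.extend_apply' _ _ n hn
  refine (iInf₂_le ψ ?_).trans (iSup_le fun n => vecStellarRank_le fun k hk => ?_)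
  · intro x y
    -- The Fock resolution of the identity is inserted between the two square roots.
    have h1 := hasSum_inner_ket_mul (S x) (S y)
    rw [hS, hSS] at h1
    rw [← he.hasSum_iff]
    · refine h1.congr_fun fun k => ?_
      simp only [Function.comp, hψ, hS]
    · intro n hn
      simp [hψ0 n hn]
  · by_cases hn : n ∈ Set.range e
    · obtain ⟨l, rfl⟩ := hn
      rw [hψ, ← inner_ket_left, ← hS, hSket k hk, inner_zero_left]
    · rw [hψ0 n hn]
      rfl

end Bosonic

theorem mainTheorem5 (m n : ℕ)
    (ρ : Bosonic.Fock (Fin m ⊕ Fin n) →L[ℂ] Bosonic.Fock (Fin m ⊕ Fin n))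
    (hρ : Bosonic.IsGaussianState ρ) :
    (∀ (A : Matrix (Bosonic.ModeWise (Fin m) (Fin n)) (Bosonic.ModeWise (Fin m) (Fin n)) ℂ)
        (b : Bosonic.ModeWise (Fin m) (Fin n) → ℂ) (c : ℂ), Bosonic.HasAbc ρ A b c →
        (Bosonic.IsGaussianCoreState ρ ↔ A.toBlocks₁₁ = 0 ∧ ∀ i, b (Sum.inl i) = 0)) ∧
      (Bosonic.IsGaussianCoreState ρ →
        ∀ k : Fin n → ℕ,
          Bosonic.stellarRank (Bosonic.postSelected ρ k) ≤ ((∑ i, k i : ℕ) : ℕ∞)) := by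
  refine ⟨fun A b c h => ⟨fun hcore => Bosonic.block_eq_zero hcore h, fun hz => ⟨hρ, fun k₁ k₂ =>
    Bosonic.hasFiniteFockSupport_partialElement h hz.1 hz.2 k₁ k₂⟩⟩, fun hcore k => ?_⟩
  obtain ⟨A, b, c, h⟩ := hρ.2
  obtain ⟨hA, hb⟩ := Bosonic.block_eq_zero hcore h
  refine Bosonic.stellarRank_le (Bosonic.postSelected_isPositive hρ.1.1 k) fun j hj => ?_
  rw [Bosonic.postSelected, Bosonic.inner_ket_partialElement_ket]
  -- On the diagonal both degrees double, so the threshold is `∑ i, k i` rather than twice that.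
  exact Bosonic.matrixElement_eq_zero h hA hb (add_lt_add hj hj)
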